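/- **Theorem 2 (Scaled mixing inequality).** Let $G$ be a compact group with normalized Haar measure $|\cdot|$ and a compatible bi-invariant metric $d$; let $1_\eta$ denote the open ball of radius $\eta$ centred at the identity. Let $C_0\ge 1$ and $L\ge 1$ be real numbers such that $(G,d)$ is $L$-locally random with coefficient $C_0$, that is, $$\|\pi(x)-\pi(y)\|_{\mathrm{op}}\le C_0(\dim\pi)^L\,d(x,y)$$ for every irreducible unitary representation $\pi$ of $G$ and all $x,y\in G$. Suppose also that $G$ satisfies the dimension condition: there are $C_1\ge 1$ and $d_0>0$ with $$\tfrac1{C_1}\eta^{d_0}\le |1_\eta|\le C_1\eta^{d_0}\qquad\text{for all }\eta\in(0,1).$$ For $\eta>0$ put $P_\eta=\mathbf 1_{1_\eta}/|1_\eta|$ and $f_\eta=f*P_\eta$, where $(f*g)(x)=\int_G f(y)\,g(y^{-1}x)\,dy$. Then for every $\eta>0$ with $C_0\sqrt\eta\le 0.1$ and all complex-valued $f,g\in L^2(G)$, $$\|f*g\|_2^2\le 2\,\|f_\eta*g_\eta\|_2^2+\eta^{1/(2L)}\,\|f\|_2^2\,\|g\|_2^2 .$$ -/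

import Mathlib

open MeasureTheory

universe u

/-- A unitary representation of a topological group `G` on a complex Hilbert space `H`: a
homomorphism into the unitary group of `H` whose action map `G × H → H` is continuous. -/
structure UnitaryRep (G : Type*) [Group G] [TopologicalSpace G]
    (H : Type*) [NormedAddCommGroup H] [InnerProductSpace ℂ H] [CompleteSpace H] where
  toHom : G →* unitary (H →L[ℂ] H)
  continuous_action : Continuous fun p : G × H => (toHom p.1 : H →L[ℂ] H) p.2

namespace UnitaryRep

/-- The operator `π(x)`. -/
noncomputable def op {G : Type*} [Group G] [TopologicalSpace G]
    {H : Type*} [NormedAddCommGroup H] [InnerProductSpace ℂ H] [CompleteSpace H]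
    (π : UnitaryRep G H) (x : G) : H →L[ℂ] H :=
  (π.toHom x : H →L[ℂ] H)

/-- `π` is irreducible: `H` is nonzero and the only closed invariant subspaces are `0` and `H`. -/
def IsIrreducible {G : Type*} [Group G] [TopologicalSpace G]
    {H : Type*} [NormedAddCommGroup H] [InnerProductSpace ℂ H] [CompleteSpace H]
    (π : UnitaryRep G H) : Prop :=
  Nontrivial H ∧
    ∀ W : Submodule ℂ H, IsClosed (W : Set H) →
      (∀ x : G, ∀ v ∈ W, π.op x v ∈ W) → W = ⊥ ∨ W = ⊤

end UnitaryRep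

/-- `(G, d)` is `L`-locally random with coefficient `C₀`, where `d` is the distance of the
metric space `G`: one has `C₀ ≥ 1` and `L ≥ 1`, the metric is bi-invariant, and
`‖π(x) - π(y)‖ ≤ C₀ (dim π)^L d(x, y)` for all irreducible unitary representations `π` of `G`.
An irreducible unitary representation of a compact group is finite-dimensional, so
`FiniteDimensional ℂ H` excludes none of them; it makes sure that `Module.finrank ℂ H` is the
dimension. -/
def IsLocallyRandom (G : Type u) [Group G] [MetricSpace G] (L C₀ : ℝ) : Prop :=
  1 ≤ C₀ ∧ 1 ≤ L ∧
  (∀ z x y : G, dist (z * x) (z * y) = dist x y) ∧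
  (∀ z x y : G, dist (x * z) (y * z) = dist x y) ∧
  ∀ (H : Type u) [NormedAddCommGroup H] [InnerProductSpace ℂ H] [CompleteSpace H]
    [FiniteDimensional ℂ H] (π : UnitaryRep G H), π.IsIrreducible →
    ∀ x y : G, ‖π.op x - π.op y‖ ≤ C₀ * (Module.finrank ℂ H : ℝ) ^ L * dist x y

/-- The dimension condition `DC(C₁, d₀)` for a metric group `G` with (Haar) measure `μ`. -/
def DimensionCondition {G : Type*} [Group G] [MetricSpace G] [MeasurableSpace G]
    (μ : Measure G) (C₁ d₀ : ℝ) : Prop :=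
  1 ≤ C₁ ∧ 0 < d₀ ∧
  ∀ η : ℝ, 0 < η → η < 1 →
    1 / C₁ * η ^ d₀ ≤ μ.real (Metric.ball (1 : G) η) ∧
    μ.real (Metric.ball (1 : G) η) ≤ C₁ * η ^ d₀

/-- The convolution `(f * g)(x) = ∫ f(y) g(y⁻¹ x) dμ(y)`. -/
noncomputable def groupConv {G : Type*} [Group G] [MeasurableSpace G]
    (μ : Measure G) (f g : G → ℂ) : G → ℂ :=
  fun x => ∫ y, f y * g (y⁻¹ * x) ∂μ

/-- `P_η`, the `L¹`-normalized indicator function of the open ball of radius `η` about `1`. -/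
noncomputable def ballKernel {G : Type*} [Group G] [MetricSpace G] [MeasurableSpace G]
    (μ : Measure G) (η : ℝ) : G → ℂ :=
  (Metric.ball (1 : G) η).indicator fun _ => ((μ.real (Metric.ball (1 : G) η))⁻¹ : ℂ)

/-- `f_η = f * P_η`. -/
noncomputable def smoothAt {G : Type*} [Group G] [MetricSpace G] [MeasurableSpace G]
    (μ : Measure G) (η : ℝ) (f : G → ℂ) : G → ℂ :=
  groupConv μ f (ballKernel μ η)

/-!
The convolution `f * g` is a matrix coefficient of the right regular representation `R` on
`L²(G)`: with `u(y) = conj (f (y⁻¹))` one has `(f * g)(x) = ⟪u, R(x) g⟫` (`inner_conjInv`).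
Hence `‖f * g‖² = ⟪g, T g⟫` for the positive operator `T = ∫ R(x)⁻¹ |u⟩⟨u| R(x) dx`
(`UnitaryRep.energyOp`), which is compact, commutes with `R`, and has trace at most
`‖u‖² = ‖f‖²`. The ball kernel `P` is central because the metric is bi-invariant, so associativity
of convolution gives `f_η * g_η = ((f * g) * P) * P`, the matrix coefficient of `B² g`, where
`B = ∫ P(z) R(z⁻¹) dz` (`inner_average_op`). The claim thus compares `⟪g, T g⟫` with
`⟪B² g, T B² g⟫`.

By the spectral theorem `L²(G)` is the closed orthogonal sum of the eigenspaces of `T`. They are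
invariant under `R`, hence under `B`, and for nonzero eigenvalues they are finite-dimensional and
split orthogonally into irreducible subspaces `W`. Let `W` have dimension `n` and eigenvalue `λ`.
If `n ≥ η ^ (-1 / (2 L))`, the trace bound `n λ ≤ ‖f‖²` makes `λ` at most
`η ^ (1 / (2 L)) ‖f‖²`. Otherwise local randomness shows that the operators of `R` move the unit
vectors of `W` by at most `C₀ n ^ L η ≤ C₀ √η ≤ 1 / 10` over the ball, so `‖B w‖ ≥ (9 / 10) ‖w‖` on
`W`, and `‖w‖² ≤ 2 ‖B² w‖²` because `(9 / 10)⁴ > 1 / 2`. Both sides are additive over orthogonal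
sums and continuous, which gives the inequality in general (`UnitaryRep.energy_le`).

Decomposing only along `T` takes the place of the Peter–Weyl theorem.
-/

namespace UnitaryRep

open InnerProductSpace Module.End

/-! ### Unitary representations and invariant subspaces -/

section Basic

variable {G : Type*} [Group G] [TopologicalSpace G]
  {H : Type*} [NormedAddCommGroup H] [InnerProductSpace ℂ H] [CompleteSpace H]

/-- The unitary representation given by a jointly continuous homomorphism into the
norm-preserving bounded operators. Unitarity follows because its values are invertible. -/
noncomputable def ofNormMap (ρ : G →* (H →L[ℂ] H)) (hρ : ∀ x v, ‖ρ x v‖ = ‖v‖)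
    (hc : Continuous fun p : G × H => ρ p.1 p.2) : UnitaryRep G H where
  toHom := ρ.codRestrict (unitary (H →L[ℂ] H)) fun x =>
    IsUnit.mem_unitary_of_star_mul_self ((Group.isUnit x).map ρ)
      ((ρ x).norm_map_iff_adjoint_comp_self.mp (hρ x))
  continuous_action := hc

variable (π : UnitaryRep G H)

@[simp]
theorem op_one_apply (v : H) : π.op 1 v = v := by simp [op]

theorem op_mul_apply (x y : G) (v : H) : π.op (x * y) v = π.op x (π.op y v) := by simp [op]

@[simp]
theorem op_inv_op_apply (x : G) (v : H) : π.op x⁻¹ (π.op x v) = v := by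
  rw [← op_mul_apply, inv_mul_cancel, op_one_apply]

@[simp]
theorem norm_op_apply (x : G) (v : H) : ‖π.op x v‖ = ‖v‖ := Unitary.norm_map _ _

theorem inner_op_op (x : G) (v w : H) : inner ℂ (π.op x v) (π.op x w) = inner ℂ v w :=
  Unitary.inner_map_map _ _ _

theorem inner_op_inv_left (x : G) (v w : H) :
    inner ℂ (π.op x⁻¹ v) w = inner ℂ v (π.op x w) := by
  rw [← π.inner_op_op x⁻¹ v, op_inv_op_apply]

theorem continuous_op_apply (v : H) : Continuous fun x => π.op x v :=
  π.continuous_action.comp (by fun_prop : Continuous fun x : G => (x, v))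

theorem continuous_rankOne_op [IsTopologicalGroup G] (u : H) :
    Continuous fun x => rankOne ℂ (π.op x⁻¹ u) (π.op x⁻¹ u) := by
  have h : Continuous fun x => π.op x⁻¹ u := (π.continuous_op_apply u).comp continuous_inv
  exact (ContinuousLinearMap.smulRightL ℂ H H).continuous₂.comp
    (((innerSL ℂ).continuous.comp h).prodMk h)

/-- A subspace is invariant under `π` if every operator `π(x)` maps it into itself. -/
def IsInvariant (W : Submodule ℂ H) : Prop := ∀ x, ∀ v ∈ W, π.op x v ∈ W

variable {π}

theorem IsInvariant.inf_orthogonal {W U : Submodule ℂ H} (hW : π.IsInvariant W)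
    (hU : π.IsInvariant U) : π.IsInvariant (W ⊓ Uᗮ) := fun x v hv =>
  ⟨hW x v hv.1, fun y hy => by
    rw [← inv_inv x, ← inner_op_inv_left, inv_inv]
    simpa using hv.2 _ (hU x⁻¹ y hy)⟩

variable (π) in
/-- The restriction of a unitary representation to a complete invariant subspace. -/
noncomputable def restrict (W : Submodule ℂ H) [CompleteSpace W] (hW : π.IsInvariant W) :
    UnitaryRep G W :=
  ofNormMap
    { toFun := fun x => (π.op x).restrict (hW x)
      map_one' := by ext v; simp
      map_mul' := fun x y => by ext v; simp [op_mul_apply] }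
    (fun x v => π.norm_op_apply x v)
    (Continuous.subtype_mk (π.continuous_action.comp
      (continuous_fst.prodMk (continuous_subtype_val.comp continuous_snd))) _)

end Basic

/-! ### The energy operator of a vector -/

section Energy

variable {G : Type*} [Group G] [TopologicalSpace G] [IsTopologicalGroup G] [CompactSpace G]
  [MeasurableSpace G] [BorelSpace G] (μ : Measure G) [IsProbabilityMeasure μ]
  {H : Type*} [NormedAddCommGroup H] [InnerProductSpace ℂ H] [CompleteSpace H]
  (π : UnitaryRep G H) (u : H)

/-- The operator `∫ π(x)⁻¹ |u⟩⟨u| π(x) dμ(x)`, whose quadratic form is the squared `L²` norm of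
the matrix coefficient `x ↦ ⟪u, π(x) v⟫`. -/
noncomputable def energyOp : H →L[ℂ] H :=
  ∫ x, rankOne ℂ (π.op x⁻¹ u) (π.op x⁻¹ u) ∂μ

theorem integrable_rankOne_op :
    Integrable (fun x => rankOne ℂ (π.op x⁻¹ u) (π.op x⁻¹ u)) μ :=
  (π.continuous_rankOne_op u).integrable_of_hasCompactSupport (HasCompactSupport.of_compactSpace _)

theorem energyOp_apply (v : H) :
    π.energyOp μ u v = ∫ x, inner ℂ u (π.op x v) • π.op x⁻¹ u ∂μ := by
  rw [energyOp, ContinuousLinearMap.integral_apply (π.integrable_rankOne_op μ u)]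
  simp [inner_op_inv_left]

theorem integrable_energyOp_apply (v : H) :
    Integrable (fun x => inner ℂ u (π.op x v) • π.op x⁻¹ u) μ := by
  simpa [inner_op_inv_left] using (π.integrable_rankOne_op μ u).apply_continuousLinearMap v

theorem inner_energyOp (v w : H) :
    inner ℂ v (π.energyOp μ u w) =
      ∫ x, inner ℂ u (π.op x w) * (starRingEnd ℂ) (inner ℂ u (π.op x v)) ∂μ := by
  rw [energyOp_apply, ← integral_inner (π.integrable_energyOp_apply μ u w)]
  refine integral_congr_ae (.of_forall fun x => ?_)
  simp only [inner_smul_right, ← π.inner_op_inv_left x u v, inner_conj_symm]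

theorem re_inner_energyOp (v : H) :
    (inner ℂ v (π.energyOp μ u v)).re = ∫ x, ‖inner ℂ u (π.op x v)‖ ^ 2 ∂μ := by
  rw [inner_energyOp]
  simp_rw [RCLike.mul_conj]
  norm_cast

theorem isSymmetric_energyOp : (π.energyOp μ u).IsSymmetric := fun v w => by
  change inner ℂ (π.energyOp μ u v) w = inner ℂ v (π.energyOp μ u w)
  rw [← inner_conj_symm, inner_energyOp, inner_energyOp, ← integral_conj]
  simp [mul_comm]

/-- Strong continuity of `π` makes the rank-one integrand norm-continuous, so that the integral
stays among the compact operators. -/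
theorem isCompactOperator_energyOp : IsCompactOperator (π.energyOp μ u) := by
  -- The compact operators form a closed convex set, and the integrand has rank one.
  have hconv : Convex ℝ {A : H →L[ℂ] H | IsCompactOperator A} :=
    ((compactOperator (RingHom.id ℂ) H H).restrictScalars ℝ).convex
  refine hconv.integral_mem (s := {A : H →L[ℂ] H | IsCompactOperator A})
    isClosed_setOfPred_isCompactOperator (.of_forall fun x => ?_) (π.integrable_rankOne_op μ u)
  exact (isCompactOperator_id.comp_clm (innerSL ℂ (π.op x⁻¹ u))).clm_comp
    (ContinuousLinearMap.toSpanSingleton ℂ (π.op x⁻¹ u))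

theorem energyOp_op_apply [μ.IsMulRightInvariant] (z : G) (v : H) :
    π.energyOp μ u (π.op z v) = π.op z (π.energyOp μ u v) := by
  rw [energyOp_apply, energyOp_apply,
    ← ContinuousLinearMap.integral_comp_comm _ (π.integrable_energyOp_apply μ u v),
    ← integral_mul_right_eq_self _ z⁻¹]
  simp [← op_mul_apply]

/-- The trace of the energy operator is at most `‖u‖²`, by Bessel's inequality at each point. -/
theorem sum_re_inner_energyOp_le {ι : Type*} (s : Finset ι) {e : ι → H}
    (he : Orthonormal ℂ e) : ∑ i ∈ s, (inner ℂ (e i) (π.energyOp μ u (e i))).re ≤ ‖u‖ ^ 2 := by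
  have hint : ∀ i ∈ s, Integrable (fun x => ‖inner ℂ u (π.op x (e i))‖ ^ 2) μ := fun i _ =>
    ((continuous_const.inner (𝕜 := ℂ)
      (π.continuous_op_apply (e i))).norm.pow 2).integrable_of_hasCompactSupport
        (HasCompactSupport.of_compactSpace _)
  simp_rw [re_inner_energyOp]
  rw [← integral_finsetSum s hint]
  refine (integral_mono (integrable_finsetSum s hint) (integrable_const (‖u‖ ^ 2))
    fun x => ?_).trans_eq (by simp)
  have h := he.sum_inner_products_le (π.op x⁻¹ u) (s := s)
  rw [norm_op_apply] at h
  refine (Finset.sum_le_sum fun i _ => ?_).trans h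
  rw [← π.inner_op_inv_left, norm_inner_symm]


end Energy

/-! ### Averages of the operators of a representation -/

section Average

variable {G : Type*} [Group G] [TopologicalSpace G] [IsTopologicalGroup G] [CompactSpace G]
  [MeasurableSpace G] [BorelSpace G] (μ : Measure G)
  {H : Type*} [NormedAddCommGroup H] [InnerProductSpace ℂ H] [CompleteSpace H]
  (π : UnitaryRep G H) (P : G → ℂ)

theorem integrable_smul_op {P : G → ℂ} (hP : Integrable P μ) (v : H) :
    Integrable (fun z => P z • π.op z⁻¹ v) μ := by
  refine hP.smul_bdd ‖v‖ ?_ (.of_forall fun z => by simp)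
  exact ((π.continuous_op_apply v).comp continuous_inv).aestronglyMeasurable_of_compactSpace

/-- The averaging operator `v ↦ ∫ P(z) π(z⁻¹) v dμ(z)`. -/
noncomputable def average (hP : Integrable P μ) : H →L[ℂ] H :=
  LinearMap.mkContinuous
    { toFun := fun v => ∫ z, P z • π.op z⁻¹ v ∂μ
      map_add' := fun v w => by
        rw [← integral_add (π.integrable_smul_op μ hP v) (π.integrable_smul_op μ hP w)]
        simp
      map_smul' := fun c v => by
        rw [RingHom.id_apply, ← integral_smul]
        simp [smul_comm c] }
    (∫ z, ‖P z‖ ∂μ) fun v => by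
      rw [← integral_mul_const]
      refine (norm_integral_le_integral_norm _).trans_eq ?_
      simp [norm_smul]

theorem average_apply (hP : Integrable P μ) (v : H) :
    π.average μ P hP v = ∫ z, P z • π.op z⁻¹ v ∂μ := rfl

variable {P}

theorem inner_average (hP : Integrable P μ) (v w : H) :
    inner ℂ v (π.average μ P hP w) = ∫ z, P z * inner ℂ v (π.op z⁻¹ w) ∂μ := by
  rw [average_apply, ← integral_inner (π.integrable_smul_op μ hP w)]
  simp [inner_smul_right]

theorem average_mem (hP : Integrable P μ) {W : Submodule ℂ H} [W.HasOrthogonalProjection]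
    (hW : π.IsInvariant W) {w : H} (hw : w ∈ W) : π.average μ P hP w ∈ W := by
  rw [← W.orthogonal_orthogonal]
  intro y hy
  rw [inner_average]
  simp [fun z => W.inner_left_of_mem_orthogonal (hW z⁻¹ w hw) hy]

/-- If `π(z⁻¹)` moves `w` by at most `δ` for all `z` in the support of a probability density `P`,
then so does the average. -/
theorem norm_average_sub_le (hP : Integrable P μ) (hP1 : ∫ z, P z ∂μ = 1)
    (hP2 : ∫ z, ‖P z‖ ∂μ = 1) {δ : ℝ} {w : H}
    (hδ : ∀ z, P z ≠ 0 → ‖π.op z⁻¹ w - w‖ ≤ δ) : ‖π.average μ P hP w - w‖ ≤ δ := by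
  have h : π.average μ P hP w - w = ∫ z, P z • (π.op z⁻¹ w - w) ∂μ := by
    simp_rw [smul_sub]
    rw [integral_sub (π.integrable_smul_op μ hP w) (hP.smul_const w), integral_smul_const, hP1,
      one_smul, average_apply]
  rw [h, ← one_mul δ, ← hP2, ← integral_mul_const]
  refine norm_integral_le_of_norm_le (hP.norm.mul_const δ) (.of_forall fun z => ?_)
  rw [norm_smul]
  by_cases hz : P z = 0
  · simp [hz]
  · gcongr
    exact hδ z hz

end Average



/-! ### Comparison of energies through the spectral theorem -/

section Comparison

variable {G : Type*} [Group G] [TopologicalSpace G] [IsTopologicalGroup G] [CompactSpace G]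
  [MeasurableSpace G] [BorelSpace G] (μ : Measure G) [IsProbabilityMeasure μ]
  {H : Type*} [NormedAddCommGroup H] [InnerProductSpace ℂ H] [CompleteSpace H]
  (π : UnitaryRep G H) (u : H)

instance completeSpace_eigenspace (T : H →L[ℂ] H) (lam : ℂ) :
    CompleteSpace (eigenspace (T : Module.End ℂ H) lam) := by
  have h : (eigenspace (T : Module.End ℂ H) lam : Set H) = {v | T v = lam • v} := by
    ext v
    simp
  refine IsClosed.completeSpace_coe (hs := ?_)
  rw [h]
  exact isClosed_eq T.continuous (continuous_const_smul lam)

theorem isInvariant_eigenspace_energyOp [μ.IsMulRightInvariant] (lam : ℂ) :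
    π.IsInvariant (eigenspace (π.energyOp μ u : Module.End ℂ H) lam) := fun x v hv => by
  rw [mem_eigenspace_iff] at hv ⊢
  change π.energyOp μ u v = lam • v at hv
  change π.energyOp μ u (π.op x v) = lam • π.op x v
  rw [energyOp_op_apply, hv, map_smul]

theorem re_inner_energyOp_nonneg (v : H) : 0 ≤ (inner ℂ v (π.energyOp μ u v)).re := by
  rw [re_inner_energyOp]
  positivity

variable {μ π u}

omit [CompleteSpace H] in
theorem re_mul_inner_self (c : ℂ) (v : H) : (c * inner ℂ v v).re = c.re * ‖v‖ ^ 2 := by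
  have h : inner ℂ v v = ((‖v‖ ^ 2 : ℝ) : ℂ) := by
    rw [inner_self_eq_norm_sq_to_K]
    push_cast
    rfl
  rw [h, Complex.re_mul_ofReal]

omit [IsTopologicalGroup G] [CompactSpace G] [BorelSpace G] [IsProbabilityMeasure μ] in
theorem re_inner_energyOp_of_mem_eigenspace {lam : ℂ} {v : H}
    (hv : v ∈ eigenspace (π.energyOp μ u : Module.End ℂ H) lam) :
    (inner ℂ v (π.energyOp μ u v)).re = lam.re * ‖v‖ ^ 2 := by
  rw [mem_eigenspace_iff] at hv
  change π.energyOp μ u v = lam • v at hv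
  rw [hv, inner_smul_right, re_mul_inner_self]

theorem eigenvalue_re_nonneg {lam : ℂ} {v : H} (hv0 : v ≠ 0)
    (hv : v ∈ eigenspace (π.energyOp μ u : Module.End ℂ H) lam) : 0 ≤ lam.re := by
  have h := π.re_inner_energyOp_nonneg μ u v
  rw [re_inner_energyOp_of_mem_eigenspace hv] at h
  exact nonneg_of_mul_nonneg_left h (by positivity)

/-- The multiplicity bound: an eigenvalue of the energy operator of `u` with an eigenspace of
dimension at least `n` is at most `‖u‖² / n`. -/
theorem finrank_mul_eigenvalue_le {lam : ℂ} {W : Submodule ℂ H} [FiniteDimensional ℂ W]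
    (hW : W ≤ eigenspace (π.energyOp μ u : Module.End ℂ H) lam) :
    Module.finrank ℂ W * lam.re ≤ ‖u‖ ^ 2 := by
  let b := stdOrthonormalBasis ℂ W
  have hb : Orthonormal ℂ fun i => (b i : H) := b.orthonormal.comp_linearIsometry W.subtypeₗᵢ
  have h := π.sum_re_inner_energyOp_le μ u Finset.univ hb
  have h1 : ∀ i, (inner ℂ (b i : H) (π.energyOp μ u (b i : H))).re = lam.re := fun i => by
    rw [re_inner_energyOp_of_mem_eigenspace (hW (b i).2), hb.norm_eq_one i]
    simp
  simpa [h1] using h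

variable {B : H →L[ℂ] H} {ε : ℝ}

/-- The dichotomy on a single irreducible constituent: its dimension is large, so that
the multiplicity bound makes the eigenvalue small, or `B` is close to the identity on it. -/
theorem energy_le_of_isIrreducible (hε : 0 ≤ ε) {lam : ℂ} {W : Submodule ℂ H}
    [FiniteDimensional ℂ W]
    (hW : W ≤ eigenspace (π.energyOp μ u : Module.End ℂ H) lam) (hB : ∀ w ∈ W, B w ∈ W)
    (h : 1 ≤ ε * Module.finrank ℂ W ∨ ∀ w ∈ W, ‖B w - w‖ ≤ 1 / 10 * ‖w‖) {w : H} (hw : w ∈ W) :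
    lam.re * ‖w‖ ^ 2 ≤ 2 * (lam.re * ‖B (B w)‖ ^ 2) + ε * ‖u‖ ^ 2 * ‖w‖ ^ 2 := by
  rcases eq_or_ne w 0 with rfl | hw0
  · simp
  have hlam := eigenvalue_re_nonneg hw0 (hW hw)
  rcases h with h | h
  · have h1 : lam.re ≤ ε * ‖u‖ ^ 2 := calc
      lam.re ≤ ε * Module.finrank ℂ W * lam.re := le_mul_of_one_le_left hlam h
      _ = ε * (Module.finrank ℂ W * lam.re) := mul_assoc ..
      _ ≤ ε * ‖u‖ ^ 2 := by gcongr; exact finrank_mul_eigenvalue_le hW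
    have h2 : lam.re * ‖w‖ ^ 2 ≤ ε * ‖u‖ ^ 2 * ‖w‖ ^ 2 := by gcongr
    have h3 : 0 ≤ lam.re * ‖B (B w)‖ ^ 2 := by positivity
    linarith
  · have key : ∀ v ∈ W, 9 / 10 * ‖v‖ ≤ ‖B v‖ := fun v hv => by
      have h1 := norm_sub_norm_le v (B v)
      rw [norm_sub_rev] at h1
      linarith [h v hv]
    have h1 : 81 / 100 * ‖w‖ ≤ ‖B (B w)‖ := by linarith [key w hw, key (B w) (hB w hw)]
    have h2 : ‖w‖ ^ 2 ≤ 2 * ‖B (B w)‖ ^ 2 := by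
      have := pow_le_pow_left₀ (by positivity) h1 2
      nlinarith [sq_nonneg ‖w‖]
    have h3 : 0 ≤ ε * ‖u‖ ^ 2 * ‖w‖ ^ 2 := by positivity
    nlinarith [mul_le_mul_of_nonneg_left h2 hlam]

/-- Every finite-dimensional invariant subspace of an eigenspace is an orthogonal sum of
irreducible ones, and both sides of the estimate are additive over orthogonal sums. -/
theorem energy_le_of_finiteDimensional (hε : 0 ≤ ε)
    (hB : ∀ (W : Submodule ℂ H) [CompleteSpace W], π.IsInvariant W → ∀ w ∈ W, B w ∈ W)
    (hirr : ∀ (W : Submodule ℂ H) [FiniteDimensional ℂ W] (hW : π.IsInvariant W),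
      (π.restrict W hW).IsIrreducible →
        1 ≤ ε * Module.finrank ℂ W ∨ ∀ w ∈ W, ‖B w - w‖ ≤ 1 / 10 * ‖w‖)
    {lam : ℂ} (n : ℕ) :
    ∀ (W : Submodule ℂ H) [FiniteDimensional ℂ W], Module.finrank ℂ W = n →
      π.IsInvariant W → W ≤ eigenspace (π.energyOp μ u : Module.End ℂ H) lam →
      ∀ w ∈ W, lam.re * ‖w‖ ^ 2 ≤ 2 * (lam.re * ‖B (B w)‖ ^ 2) + ε * ‖u‖ ^ 2 * ‖w‖ ^ 2 := by
  induction n using Nat.strong_induction_on with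
  | _ n ih =>
    intro W _ hn hinv hW w hw
    rcases eq_or_ne w 0 with rfl | hw0
    · simp
    by_cases hI : (π.restrict W hinv).IsIrreducible
    · exact energy_le_of_isIrreducible hε hW (hB W hinv) (hirr W hinv hI) hw
    have : Nontrivial W := ⟨⟨w, hw⟩, 0, fun h => hw0 (by simpa using h)⟩
    simp only [IsIrreducible, this, true_and, not_forall, not_or] at hI
    obtain ⟨U₀, -, hU₀inv, hU₀bot, hU₀top⟩ := hI
    -- `U` is a proper nonzero invariant subspace of `W`, and `V` its complement in `W`.
    let U : Submodule ℂ H := U₀.map W.subtype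
    have hUW : U ≤ W := Submodule.map_subtype_le W U₀
    have hUinv : π.IsInvariant U := by
      rintro x _ ⟨v, hv, rfl⟩
      exact ⟨_, hU₀inv x v hv, rfl⟩
    have hUbot : U ≠ ⊥ := fun h => hU₀bot (by
      apply Submodule.map_injective_of_injective W.injective_subtype
      rw [Submodule.map_bot]
      exact h)
    have hUne : U ≠ W := fun h => hU₀top (by
      apply Submodule.map_injective_of_injective W.injective_subtype
      rw [Submodule.map_subtype_top]
      exact h)
    have : FiniteDimensional ℂ U := Submodule.finiteDimensional_of_le hUW
    let V : Submodule ℂ H := W ⊓ Uᗮ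
    have hVW : V ≤ W := inf_le_left
    have : FiniteDimensional ℂ V := Submodule.finiteDimensional_of_le hVW
    have hVinv : π.IsInvariant V := hinv.inf_orthogonal hUinv
    have hVne : V ≠ W := fun h => hUbot (by
      rw [Submodule.eq_bot_iff]
      intro y hy
      have h1 : y ∈ Uᗮ := (h.ge (hUW hy)).2
      exact inner_self_eq_zero.mp (h1 y hy))
    have hUlt : Module.finrank ℂ U < n :=
      hn ▸ Submodule.finrank_lt_finrank_of_lt (hUW.lt_of_ne hUne)
    have hVlt : Module.finrank ℂ V < n :=
      hn ▸ Submodule.finrank_lt_finrank_of_lt (hVW.lt_of_ne hVne)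
    obtain ⟨y, hy, z, hz, rfl⟩ := U.exists_add_mem_mem_orthogonal w
    have hzV : z ∈ V := ⟨by simpa using W.sub_mem hw (hUW hy), hz⟩
    have h1 := ih _ hUlt U rfl hUinv (hUW.trans hW) y hy
    have h2 := ih _ hVlt V rfl hVinv (hVW.trans hW) z hzV
    have p1 := norm_add_sq_eq_norm_sq_add_norm_sq_of_inner_eq_zero y z (hz y hy)
    have p2 := norm_add_sq_eq_norm_sq_add_norm_sq_of_inner_eq_zero (B (B y)) (B (B z))
      ((hB V hVinv _ (hB V hVinv z hzV)).2 _ (hB U hUinv _ (hB U hUinv y hy)))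
    simp only [map_add, pow_two] at *
    rw [p1, p2]
    linarith

/-- If on each irreducible subspace of finite dimension `n` either `1 ≤ ε n` or `B` is close to the
identity, then applying `B` twice loses at most a factor `2` of the energy, up to the error
`ε ‖u‖² ‖v‖²`. Here `B` is any operator that preserves the closed invariant subspaces. -/
theorem energy_le [μ.IsMulRightInvariant] (hε : 0 ≤ ε)
    (hB : ∀ (W : Submodule ℂ H) [CompleteSpace W], π.IsInvariant W → ∀ w ∈ W, B w ∈ W)
    (hirr : ∀ (W : Submodule ℂ H) [FiniteDimensional ℂ W] (hW : π.IsInvariant W),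
      (π.restrict W hW).IsIrreducible →
        1 ≤ ε * Module.finrank ℂ W ∨ ∀ w ∈ W, ‖B w - w‖ ≤ 1 / 10 * ‖w‖) (v : H) :
    (inner ℂ v (π.energyOp μ u v)).re ≤
      2 * (inner ℂ (B (B v)) (π.energyOp μ u (B (B v)))).re + ε * ‖u‖ ^ 2 * ‖v‖ ^ 2 := by
  set T := π.energyOp μ u
  have hsymm := π.isSymmetric_energyOp μ u
  have hinv := π.isInvariant_eigenspace_energyOp μ u
  have hBE : ∀ lam, ∀ w ∈ eigenspace (T : Module.End ℂ H) lam,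
      B w ∈ eigenspace (T : Module.End ℂ H) lam := fun lam => hB _ (hinv lam)
  have heig : ∀ (lam : ℂ), ∀ w ∈ eigenspace (T : Module.End ℂ H) lam,
      lam.re * ‖w‖ ^ 2 ≤ 2 * (lam.re * ‖B (B w)‖ ^ 2) + ε * ‖u‖ ^ 2 * ‖w‖ ^ 2 := by
    intro lam w hw
    rcases eq_or_ne lam 0 with rfl | hlam
    · simp; positivity
    have := ContinuousLinearMap.finite_dimensional_eigenspace
      (π.isCompactOperator_energyOp μ u) lam hlam
    exact energy_le_of_finiteDimensional hε hB hirr _ _ rfl (hinv lam) le_rfl w hw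
  have horth : OrthogonalFamily ℂ (fun lam => eigenspace (T : Module.End ℂ H) lam)
      fun lam => (eigenspace (T : Module.End ℂ H) lam).subtypeₗᵢ :=
    hsymm.orthogonalFamily_eigenspaces
  -- On a finite sum of eigenvectors the quadratic form is diagonal.
  have hdiag : ∀ (s : Finset ℂ) (l : ∀ lam, eigenspace (T : Module.End ℂ H) lam),
      (inner ℂ (∑ i ∈ s, (l i : H)) (T (∑ i ∈ s, (l i : H)))).re =
        ∑ i ∈ s, i.re * ‖(l i : H)‖ ^ 2 := by
    intro s l
    have h1 : T (∑ i ∈ s, (l i : H)) =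
        ∑ i ∈ s, ((i • l i : eigenspace (T : Module.End ℂ H) i) : H) := by
      rw [map_sum]
      exact Finset.sum_congr rfl fun i _ => mem_eigenspace_iff.mp (l i).2
    rw [h1]
    have h2 := horth.inner_sum l (fun i => i • l i) s
    simp only [Submodule.coe_subtypeₗᵢ, Submodule.coe_subtype] at h2
    rw [h2, Complex.re_sum]
    refine Finset.sum_congr rfl fun i _ => ?_
    rw [inner_smul_right, re_mul_inner_self]
    rfl
  have hdense : Dense ((⨆ lam, eigenspace (T : Module.End ℂ H) lam : Submodule ℂ H) : Set H) := by
    rw [Submodule.dense_iff_topologicalClosure_eq_top,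
      Submodule.topologicalClosure_eq_top_iff]
    exact ContinuousLinearMap.orthogonalComplement_iSup_eigenspaces_eq_bot
      (π.isCompactOperator_energyOp μ u) hsymm
  refine hdense.induction (P := fun v => (inner ℂ v (T v)).re ≤
      2 * (inner ℂ (B (B v)) (T (B (B v)))).re + ε * ‖u‖ ^ 2 * ‖v‖ ^ 2) (fun v hv => ?_) ?_ v
  · classical
    obtain ⟨l, hl⟩ := (Submodule.mem_iSup_iff_exists_dfinsupp' _ _).mp hv
    have hlv : v = ∑ i ∈ l.support, (l i : H) := hl.symm
    have hBv : B (B v) = ∑ i ∈ l.support, B (B (l i)) := by rw [hlv, map_sum, map_sum]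
    have h1 := hdiag l.support l
    have h2 := hdiag l.support fun i => ⟨B (B (l i)), hBE i _ (hBE i _ (l i).2)⟩
    have h3 := horth.norm_sum (fun i => l i) l.support
    simp only [Submodule.coe_subtypeₗᵢ, Submodule.coe_subtype, Submodule.coe_norm] at h3
    rw [hBv, h2, hlv, h1, h3, Finset.mul_sum, Finset.mul_sum, ← Finset.sum_add_distrib]
    exact Finset.sum_le_sum fun i _ => heig i _ (l i).2
  · exact isClosed_le (by fun_prop) (by fun_prop)

end Comparison
end UnitaryRep

/-! ### Haar measure on a compact group -/

section Haar

variable {G : Type*} [Group G] [TopologicalSpace G] [IsTopologicalGroup G] [CompactSpace G]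
  [MeasurableSpace G] [BorelSpace G] (μ : Measure G) [μ.IsHaarMeasure] [IsProbabilityMeasure μ]

/-- Uniqueness of the normalized Haar measure among all left-invariant probability measures. It
gives the right and inversion invariance of `μ`. -/
theorem haar_eq_of_isMulLeftInvariant (ν : Measure G) [ν.IsMulLeftInvariant]
    [IsProbabilityMeasure ν] : ν = μ := by
  have h := Measure.isMulInvariant_eq_smul_of_compactSpace ν μ
  have h1 := congrArg (fun m : Measure G => m Set.univ) h
  simp only [measure_univ, Measure.smul_apply, ENNReal.smul_def, smul_eq_mul, mul_one] at h1
  rw [h, show Measure.haarScalarFactor ν μ = 1 by exact_mod_cast h1.symm, one_smul]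

theorem isMulRightInvariant_of_compactSpace : μ.IsMulRightInvariant where
  map_mul_right_eq_self g := by
    have : IsProbabilityMeasure (μ.map (· * g)) :=
      Measure.isProbabilityMeasure_map (measurable_mul_const g).aemeasurable
    exact haar_eq_of_isMulLeftInvariant μ _

theorem isInvInvariant_of_compactSpace : μ.IsInvInvariant where
  inv_eq_self := by
    have := isMulRightInvariant_of_compactSpace μ
    have : IsProbabilityMeasure μ.inv :=
      Measure.isProbabilityMeasure_map measurable_inv.aemeasurable
    exact haar_eq_of_isMulLeftInvariant μ _

end Haar

/-! ### The right regular representation -/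

section RegularRep

variable {G : Type*} [Group G] [TopologicalSpace G] [IsTopologicalGroup G] [CompactSpace G]
  [R1Space G] [MeasurableSpace G] [BorelSpace G] (μ : Measure G) [IsFiniteMeasure μ]
  [μ.InnerRegularCompactLTTop] [μ.IsMulRightInvariant]

/-- The right regular representation `(R(x) v)(y) = v(y x)` on `L²(G)`. -/
noncomputable def regularRep : UnitaryRep G (Lp ℂ 2 μ) :=
  UnitaryRep.ofNormMap
    { toFun := fun x => (Lp.compMeasurePreservingₗᵢ ℂ (· * x)
        (measurePreserving_mul_right μ x)).toContinuousLinearMap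
      map_one' := by
        ext1 v
        refine Lp.ext ((Lp.coeFn_compMeasurePreserving v _).trans ?_)
        simp [Function.comp_def]
      map_mul' := fun x y => by
        ext1 v
        refine Lp.ext ((Lp.coeFn_compMeasurePreserving v _).trans ?_)
        refine .trans ?_ (Lp.coeFn_compMeasurePreserving _
          (measurePreserving_mul_right μ x)).symm
        refine .trans ?_ ((measurePreserving_mul_right μ x).quasiMeasurePreserving.ae_eq_comp
          (Lp.coeFn_compMeasurePreserving v (measurePreserving_mul_right μ y))).symm
        simp [Function.comp_def, mul_assoc] }
    (fun x v => Lp.norm_compMeasurePreserving v _)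
    (by
      let g : C(G × Lp ℂ 2 μ, C(G, G)) :=
        (ContinuousMap.mk (fun a : G × G => a.2 * a.1) (by fun_prop)).curry.comp
          ContinuousMap.fst
      exact continuous_snd.compMeasurePreservingLp g.continuous
        (fun p => measurePreserving_mul_right μ p.1) (by simp))

theorem coeFn_regularRep_op (x : G) (v : Lp ℂ 2 μ) :
    (regularRep μ).op x v =ᵐ[μ] fun y => v (y * x) :=
  Lp.coeFn_compMeasurePreserving v (measurePreserving_mul_right μ x)

end RegularRep

/-! ### Convolutions as matrix coefficients -/

section Convolution

theorem lpNorm_two_sq_eq_integral {X : Type*} [MeasurableSpace X] {μ : Measure X} {f : X → ℂ}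
    (hf : AEStronglyMeasurable f μ) : lpNorm f 2 μ ^ 2 = ∫ x, ‖f x‖ ^ 2 ∂μ := by
  have h : 0 ≤ ∫ x, ‖f x‖ ^ 2 ∂μ := by positivity
  rw [lpNorm_eq_integral_norm_rpow_toReal (by norm_num) (by norm_num) hf]
  simp only [ENNReal.toReal_ofNat, Real.rpow_ofNat]
  rw [← one_div, ← Real.sqrt_eq_rpow, Real.sq_sqrt h]

theorem memLp_of_continuous {X : Type*} [TopologicalSpace X] [CompactSpace X] [R1Space X]
    [MeasurableSpace X] [BorelSpace X] (μ : Measure X) [IsFiniteMeasure μ] {f : X → ℂ}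
    (hf : Continuous f) : MemLp f 2 μ :=
  hf.memLp_of_hasCompactSupport (HasCompactSupport.of_compactSpace _)

variable {G : Type*} [Group G] [TopologicalSpace G] [IsTopologicalGroup G] [MeasurableSpace G]
  [BorelSpace G] (μ : Measure G)

theorem memLp_conj_inv [μ.IsInvInvariant] {f : G → ℂ} (hf : MemLp f 2 μ) :
    MemLp (fun y => (starRingEnd ℂ) (f y⁻¹)) 2 μ :=
  (hf.comp_measurePreserving (Measure.measurePreserving_inv μ)).star

theorem groupConv_assoc [SecondCountableTopology G] [IsFiniteMeasure μ] [μ.IsMulLeftInvariant]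
    {a b c : G → ℂ} (ha : Integrable a μ)
    (hb : Integrable b μ) (hc : Measurable c) {C : ℝ} (hC : ∀ x, ‖c x‖ ≤ C) :
    groupConv μ (groupConv μ a b) c = groupConv μ a (groupConv μ b c) := by
  funext x
  have hint : Integrable (fun p : G × G => a p.1 * b (p.1⁻¹ * p.2) * c (p.2⁻¹ * x))
      (μ.prod μ) := by
    have h1 := ((measurePreserving_prod_inv_mul μ μ).integrable_comp
      (ha.mul_prod hb).aestronglyMeasurable).mpr (ha.mul_prod hb)
    refine h1.mul_bdd (c := C) ?_ (.of_forall fun p => hC _)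
    exact (hc.comp (by fun_prop)).aestronglyMeasurable
  simp only [groupConv, ← integral_mul_const, ← integral_const_mul]
  rw [integral_integral_swap (f := fun y z => a z * b (z⁻¹ * y) * c (y⁻¹ * x)) hint.swap]
  refine integral_congr_ae (.of_forall fun z => ?_)
  simp only
  rw [← integral_mul_left_eq_self _ z]
  simp [mul_assoc]

theorem groupConv_comm_of_central [μ.IsMulLeftInvariant] [μ.IsInvInvariant] {P : G → ℂ}
    (hP : ∀ x y, P (x * y) = P (y * x)) (h : G → ℂ) :
    groupConv μ P h = groupConv μ h P := by
  funext x
  rw [groupConv, ← integral_div_left_eq_self _ μ x, groupConv]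
  refine integral_congr_ae (.of_forall fun y => ?_)
  simp [div_eq_mul_inv, mul_comm, hP x]

/-- The vector `y ↦ conj (f y⁻¹)` of `L²(G)`, whose matrix coefficients in the regular
representation are the convolutions with `f`. -/
noncomputable def conjInv [μ.IsInvInvariant] {f : G → ℂ} (hf : MemLp f 2 μ) : Lp ℂ 2 μ :=
  (memLp_conj_inv μ hf).toLp

theorem norm_conjInv [μ.IsInvInvariant] {f : G → ℂ} (hf : MemLp f 2 μ) :
    ‖conjInv μ hf‖ = lpNorm f 2 μ := by
  rw [conjInv, Lp.norm_toLp, ← toReal_eLpNorm hf.1]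
  congr 1
  refine (eLpNorm_congr_norm_ae (g := f ∘ Inv.inv) (.of_forall fun y => by simp)).trans ?_
  exact eLpNorm_comp_measurePreserving hf.1 (Measure.measurePreserving_inv μ)

/-- Averaging over translates convolves the matrix coefficients on the right. -/
theorem inner_average_op [CompactSpace G] [μ.IsMulLeftInvariant]
    [μ.IsInvInvariant] {H : Type*} [NormedAddCommGroup H]
    [InnerProductSpace ℂ H] [CompleteSpace H] (π : UnitaryRep G H) {P : G → ℂ}
    (hP : Integrable P μ) (u v : H) (x : G) :
    inner ℂ u (π.op x (π.average μ P hP v)) =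
      groupConv μ (fun y => inner ℂ u (π.op y v)) P x := by
  rw [← π.inner_op_inv_left x u, UnitaryRep.inner_average, groupConv,
    ← integral_div_left_eq_self (fun y => inner ℂ u (π.op y v) * P (y⁻¹ * x)) μ x]
  refine integral_congr_ae (.of_forall fun z => ?_)
  simp only [π.inner_op_inv_left, ← π.op_mul_apply, div_eq_mul_inv]
  simp [mul_comm]

variable [CompactSpace G] [R1Space G] [IsFiniteMeasure μ] [μ.InnerRegularCompactLTTop]
  [μ.IsMulRightInvariant] [μ.IsInvInvariant]

theorem inner_conjInv {f : G → ℂ} (hf : MemLp f 2 μ) {g : G → ℂ} {v : Lp ℂ 2 μ} (hv : v =ᵐ[μ] g)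
    (x : G) : inner ℂ (conjInv μ hf) ((regularRep μ).op x v) = groupConv μ f g x := by
  rw [L2.inner_def, groupConv, ← integral_inv_eq_self _ μ]
  have h1 := (measurePreserving_mul_right μ x).quasiMeasurePreserving.ae_eq_comp hv
  have h2 := (Measure.measurePreserving_inv μ).quasiMeasurePreserving.ae_eq_comp
    ((coeFn_regularRep_op μ x v).trans h1)
  have h3 := (Measure.measurePreserving_inv μ).quasiMeasurePreserving.ae_eq_comp
    (memLp_conj_inv μ hf).coeFn_toLp
  refine integral_congr_ae ?_
  filter_upwards [h2, h3] with y hy2 hy3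
  simp only [Function.comp_apply] at hy2 hy3
  rw [hy2, conjInv, hy3]
  simp [mul_comm]

theorem continuous_groupConv {f g : G → ℂ} (hf : MemLp f 2 μ) (hg : MemLp g 2 μ) :
    Continuous (groupConv μ f g) := by
  simp_rw [funext fun x => (inner_conjInv μ hf hg.coeFn_toLp x).symm]
  exact continuous_const.inner ((regularRep μ).continuous_op_apply _)

end Convolution

/-! ### The normalized indicator of a ball -/

section BallKernel

variable {G : Type*} [Group G] [MetricSpace G] [MeasurableSpace G] (μ : Measure G) {η : ℝ}

theorem ballKernel_mul_comm (hd : ∀ z x y : G, dist (z * x) (z * y) = dist x y)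
    (hd' : ∀ z x y : G, dist (x * z) (y * z) = dist x y) (x y : G) :
    ballKernel μ η (x * y) = ballKernel μ η (y * x) := by
  have h : dist (x * y) 1 = dist (y * x) 1 := by
    rw [← hd y, ← hd' y⁻¹]
    simp [mul_assoc]
  simp only [ballKernel, Set.indicator, Metric.mem_ball, h]

theorem measurable_ballKernel [OpensMeasurableSpace G] : Measurable (ballKernel μ η) :=
  measurable_const.indicator measurableSet_ball

theorem norm_ballKernel_le (x : G) :
    ‖ballKernel μ η x‖ ≤ (μ.real (Metric.ball (1 : G) η))⁻¹ := by
  refine (norm_indicator_le_norm_self _ _).trans_eq ?_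
  simp

variable [BorelSpace G]

theorem memLp_ballKernel [IsFiniteMeasure μ] : MemLp (ballKernel μ η) 2 μ :=
  .of_bound (measurable_ballKernel μ).aestronglyMeasurable _
    (.of_forall (norm_ballKernel_le μ))

theorem integral_ballKernel [IsFiniteMeasure μ] [μ.IsOpenPosMeasure] (hη : 0 < η) :
    ∫ x, ballKernel μ η x ∂μ = 1 := by
  have h : μ.real (Metric.ball (1 : G) η) ≠ 0 :=
    (ENNReal.toReal_pos (Metric.measure_ball_pos μ 1 hη).ne' (measure_ne_top _ _)).ne'
  rw [ballKernel, integral_indicator_const _ measurableSet_ball, Complex.real_smul,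
    mul_inv_cancel₀ (by exact_mod_cast h)]

theorem integral_norm_ballKernel [IsFiniteMeasure μ] [μ.IsOpenPosMeasure] (hη : 0 < η) :
    ∫ x, ‖ballKernel μ η x‖ ∂μ = 1 := by
  have h : μ.real (Metric.ball (1 : G) η) ≠ 0 :=
    (ENNReal.toReal_pos (Metric.measure_ball_pos μ 1 hη).ne' (measure_ne_top _ _)).ne'
  simp_rw [ballKernel, norm_indicator_eq_indicator_norm]
  rw [integral_indicator_const _ measurableSet_ball]
  simp only [smul_eq_mul, norm_inv, Complex.norm_real, Real.norm_of_nonneg measureReal_nonneg]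
  exact mul_inv_cancel₀ h

end BallKernel

/-! ### The mixing inequality -/

/-- The threshold `D = η ^ (-1 / (2 L))` separates the dimensions: above it the multiplicity
bound saves `η ^ (1 / (2 L))`, and up to it the representation moves by at most `1 / 10` on the
ball of radius `η`. -/
theorem dim_dichotomy {L C₀ η : ℝ} (hL : 1 ≤ L) (hC₀ : 1 ≤ C₀) (hη : 0 < η)
    (hC₀η : C₀ * √η ≤ 1 / 10) (n : ℕ) :
    1 ≤ η ^ (1 / (2 * L)) * n ∨ C₀ * (n : ℝ) ^ L * η ≤ 1 / 10 := by
  rcases le_total 1 (η ^ (1 / (2 * L)) * n) with h | h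
  · exact .inl h
  · right
    have h1 : (η ^ (1 / (2 * L)) * n) ^ L ≤ 1 := Real.rpow_le_one (by positivity) h (by linarith)
    rw [Real.mul_rpow (by positivity) (by positivity), ← Real.rpow_mul hη.le,
      show 1 / (2 * L) * L = 1 / 2 by field_simp, ← Real.sqrt_eq_rpow] at h1
    calc C₀ * (n : ℝ) ^ L * η = C₀ * √η * (√η * (n : ℝ) ^ L) := by
          nth_rw 1 [← Real.mul_self_sqrt hη.le]; ring
      _ ≤ C₀ * √η * 1 := by gcongr
      _ ≤ 1 / 10 := by linarith

theorem theorem2 {G : Type u} [Group G] [MetricSpace G] [IsTopologicalGroup G] [CompactSpace G]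
    [MeasurableSpace G] [BorelSpace G]
    (μ : Measure G) [μ.IsHaarMeasure] [IsProbabilityMeasure μ]
    (L C₀ : ℝ) (hG : IsLocallyRandom G L C₀)
    (C₁ d₀ : ℝ) (hdim : DimensionCondition μ C₁ d₀)
    (η : ℝ) (hη : 0 < η) (hC₀η : C₀ * √η ≤ 1 / 10)
    (f g : G → ℂ) (hf : MemLp f 2 μ) (hg : MemLp g 2 μ) :
    MemLp (groupConv μ f g) 2 μ ∧
    MemLp (groupConv μ (smoothAt μ η f) (smoothAt μ η g)) 2 μ ∧
    lpNorm (groupConv μ f g) 2 μ ^ 2 ≤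
      2 * lpNorm (groupConv μ (smoothAt μ η f) (smoothAt μ η g)) 2 μ ^ 2 +
        η ^ (1 / (2 * L)) * lpNorm f 2 μ ^ 2 * lpNorm g 2 μ ^ 2 := by
  obtain ⟨hC₀, hL, hd, hd', hrep⟩ := hG
  have := isMulRightInvariant_of_compactSpace μ
  have := isInvInvariant_of_compactSpace μ
  set P := ballKernel μ η
  have hP2 : MemLp P 2 μ := memLp_ballKernel μ
  have hP : Integrable P μ := hP2.integrable (by norm_num)
  have hf1 : Integrable f μ := hf.integrable (by norm_num)
  have hfη : Continuous (smoothAt μ η f) := continuous_groupConv μ hf hP2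
  have hgη : Continuous (smoothAt μ η g) := continuous_groupConv μ hg hP2
  have hfg : Continuous (groupConv μ f g) := continuous_groupConv μ hf hg
  have hfgη : Continuous (groupConv μ (smoothAt μ η f) (smoothAt μ η g)) :=
    continuous_groupConv μ (memLp_of_continuous μ hfη) (memLp_of_continuous μ hgη)
  refine ⟨memLp_of_continuous μ hfg, memLp_of_continuous μ hfgη, ?_⟩
  let π := regularRep μ
  let u := conjInv μ hf
  let v := hg.toLp
  let B := π.average μ P hP
  have hcoef : (fun x => inner ℂ u (π.op x v)) = groupConv μ f g :=
    funext (inner_conjInv μ hf hg.coeFn_toLp)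
  -- Since `P` is central, both copies of it can be moved to the right end of the product.
  have hcoefη : (fun x => inner ℂ u (π.op x (B (B v)))) =
      groupConv μ (smoothAt μ η f) (smoothAt μ η g) := by
    obtain ⟨C, hC⟩ := isCompact_univ.exists_bound_of_continuousOn hgη.continuousOn
    have hPle := norm_ballKernel_le (η := η) μ
    have hPm := measurable_ballKernel (η := η) μ
    calc (fun x => inner ℂ u (π.op x (B (B v))))
        = groupConv μ (groupConv μ (groupConv μ f g) P) P := by
          simp_rw [B, inner_average_op, ← hcoef]
      _ = groupConv μ f (groupConv μ (smoothAt μ η g) P) := by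
          rw [groupConv_assoc μ hf1 (hg.integrable (by norm_num)) hPm hPle]
          exact groupConv_assoc μ hf1
            ((memLp_of_continuous μ hgη).integrable (by norm_num)) hPm hPle
      _ = groupConv μ f (groupConv μ P (smoothAt μ η g)) := by
          rw [groupConv_comm_of_central μ (ballKernel_mul_comm μ hd hd')]
      _ = groupConv μ (smoothAt μ η f) (smoothAt μ η g) :=
          (groupConv_assoc μ hf1 hP hgη.measurable fun x => hC x trivial).symm
  -- On an irreducible subspace the dimension decides which alternative holds.
  have key := UnitaryRep.energy_le (π := π) (μ := μ) (u := u) (B := B) (ε := η ^ (1 / (2 * L)))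
    (by positivity) (fun W _ hW w hw => π.average_mem μ hP hW hw) (fun W _ hW hI => ?_) v
  · rw [UnitaryRep.re_inner_energyOp, UnitaryRep.re_inner_energyOp] at key
    rw [lpNorm_two_sq_eq_integral (memLp_of_continuous μ hfg).1,
       lpNorm_two_sq_eq_integral (memLp_of_continuous μ hfgη).1, ← hcoef, ← hcoefη,
      ← norm_conjInv μ hf,
      ← toReal_eLpNorm hg.1, ← Lp.norm_toLp g hg]
    exact key
  · refine (dim_dichotomy hL hC₀ hη hC₀η (Module.finrank ℂ W)).imp_right fun hdim w hw => ?_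
    refine π.norm_average_sub_le μ hP (integral_ballKernel μ hη) (integral_norm_ballKernel μ hη)
      fun z hz => ?_
    have hz : dist z 1 < η := Metric.mem_ball.mp (Set.mem_of_indicator_ne_zero hz)
    have hz' : dist z⁻¹ 1 < η := by
      rw [← hd z]
      simpa [dist_comm] using hz
    have h1 := hrep W (π.restrict W hW) hI z⁻¹ 1
    calc ‖π.op z⁻¹ w - w‖
        = ‖((π.restrict W hW).op z⁻¹ - (π.restrict W hW).op 1) ⟨w, hw⟩‖ := by
          rw [sub_apply, UnitaryRep.op_one_apply]
          rfl
      _ ≤ C₀ * (Module.finrank ℂ W : ℝ) ^ L * dist z⁻¹ 1 * ‖w‖ :=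
          ContinuousLinearMap.le_of_opNorm_le _ h1 _
      _ ≤ C₀ * (Module.finrank ℂ W : ℝ) ^ L * η * ‖w‖ := by gcongr
      _ ≤ 1 / 10 * ‖w‖ := by gcongr
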